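/- **Setting.** There are $n=5f+1$ players with $f\ge 3$, each correct, rational or Byzantine; $k$ are rational, $t\le f$ are Byzantine, and the coalition of size $C=k+t$ satisfies $C\le\lfloor(11f+2)/3\rfloor$ (the winner-consensus window). No other relation between $n,k,t$ is assumed; in particular neither $n>2(k+t)$ nor $n>\frac32k+3t$. The network is asynchronous, signatures are unforgeable, and encryption is symbolic: $\mathrm{Enc}(k_i,\cdot)$ is opened exactly by $k_i^{-1}$. **BFTCR.** Player $i$ reliably broadcasts in RB1 (Bracha's protocol with signed payloads) one commitment, $\mathrm{Enc}(k_i,\mathit{PoFs})$ with a valid bundle of proofs of fraud (PoFs: pairs of conflicting signed votes) or $\mathrm{Enc}(k_i,H(v_i))$. Having RB-delivered at least $4f+1$ commitments, it reliably broadcasts in RB2 the list of the commitments delivered to it. Having delivered at least $4f+1$ RB2 lists as well, it reveals $k_i^{-1}$. Correct players follow the protocol. Coalition members may deviate arbitrarily, also inside the reliable broadcasts. A *baiter* is a rational player who commits a valid bundle $\mathrm{Enc}(k_b,\mathit{PoFs})$ in RB1 and no other commitment, delivers according to the broadcast protocol, and does not reveal before the protocol allows it; the number of baiters is arbitrary (for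 instance $m(k,t)$). **Fork.** An execution forks into $a\ge2$ branches if the correct players are partitioned into $a$ classes, one per branch, and each branch $r$ has its own value $v_r$ (distinct for distinct branches) and a quorum $W_r$ of at least $4f+1$ players such that all members of $W_r$ voted for $v_r$ (in one common view), and the RB1 messages of all members of $W_r$ are delivered to the correct players of class $r$ before these start RB2. The set of detected equivocators is $E=\bigcup_{r\ne s}W_r\cap W_s$. A player *takes part in the fork as an equivocator* if it belongs to $W_r$ for every $r$. **Valid candidate.** Player $j$ is a valid candidate if it reveals $k_j^{-1}$ and there are a ciphertext $c$ that $k_j^{-1}$ decrypts to a valid PoF bundle and a set $Q$ of at least $f+1$ players outside $E$ such that for every $q\in Q$ the RB2 list broadcast by $q$ contains $c$ as the commitment of $j$ (a player that broadcasts two different RB2 lists is not counted). **Lemma (Valid-candidacy).** In every forked execution: 1. Every baiter that takes part in the fork as an equivocator and reveals its key is a valid candidate. 2. No non-baiter is a valid candidate, whatever deviations from the reliable broadcast sub-protocol occur: - if no RB1 commitment to a valid PoF bundle signed by $j$ is ever sent, then $j$ is not a valid candidate, even if lists of players outside $E$ that broadcast several different RB2 lists are counted; - if some correct player or baiter reveals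 its key at a time before which no message contains a commitment of $j$ to a valid PoF bundle (neither as an RB1 commitment signed by $j$ nor as an entry for $j$ in an RB2 list), then $j$ is not a valid candidate. -/

import Mathlib

namespace SNARE

/-- The `n = 5f + 1` players. -/
abbrev Player (f : ℕ) : Type := Fin (5 * f + 1)

/-- Types of players.  The coalition consists of the rational and the Byzantine players. -/
inductive Role : Type
  | correct
  | rational
  | byzantine
  deriving DecidableEq

/-! ### Messages (symbolic cryptography) -/

/-- A signed vote of the accountable consensus layer. -/
structure Vote (f : ℕ) (V : Type*) where
  signer : Player f
  view : ℕ
  value : V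

/-- A proof of fraud: the two signed votes of `culprit` in `view` for `value₁` and `value₂`. -/
structure PoF (f : ℕ) (V : Type*) where
  culprit : Player f
  view : ℕ
  value₁ : V
  value₂ : V

/-- What is committed in RB1: the hash of a value or a bundle of proofs of fraud. -/
inductive Plain (f : ℕ) (V : Type*) : Type _
  | hash (v : V)
  | pofs (B : List (PoF f V))

/-- `⟨i, d⟩` is the ciphertext `Enc(k_i, d)`. -/
structure Cipher (f : ℕ) (V : Type*) where
  owner : Player f
  plain : Plain f V

/-- `Dec(c, k_i⁻¹)`; decryption with a key that does not match fails. -/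
def Cipher.dec {f : ℕ} {V : Type*} (c : Cipher f V) (i : Player f) : Option (Plain f V) :=
  if c.owner = i then some c.plain else none

/-- `Verify` for a bundle: it is nonempty and each item consists of two conflicting votes. -/
def VerifyPoFs {f : ℕ} {V : Type*} (B : List (PoF f V)) : Prop :=
  B ≠ [] ∧ ∀ π ∈ B, π.value₁ ≠ π.value₂

/-- `c` is an encryption, under the key of player `j`, of a valid bundle of proofs of fraud. -/
def IsPoFCommitment {f : ℕ} {V : Type*} (j : Player f) (c : Cipher f V) : Prop :=
  ∃ B, c.dec j = some (Plain.pofs B) ∧ VerifyPoFs B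

/-- What is reliably broadcast: a commitment (in RB1) or a list of commitments (in RB2); the
entry of the list at `j` is the commitment delivered from `RB1_j`, if any. -/
inductive Payload (f : ℕ) (V : Type*) : Type _
  | commit (c : Cipher f V)
  | list (L : Player f → Option (Cipher f V))

/-- A payload together with the signature of the player who broadcasts it. -/
structure Signed (f : ℕ) (V : Type*) where
  signer : Player f
  payload : Payload f V

/-- Both payloads belong to the same instance `RB1_i`, or to the same instance `RB2_i`. -/
def Signed.SameInstance {f : ℕ} {V : Type*} : Signed f V → Signed f V → Prop
  | ⟨i, .commit _⟩, ⟨j, .commit _⟩ => i = j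
  | ⟨i, .list _⟩, ⟨j, .list _⟩ => i = j
  | _, _ => False

/-- Network messages: votes, the three messages of Bracha's reliable broadcast, and the
decryption key `k_i⁻¹`. -/
inductive Msg (f : ℕ) (V : Type*) : Type _
  | vote (w : Vote f V)
  | init (s : Signed f V)
  | echo (s : Signed f V)
  | ready (s : Signed f V)
  | key (i : Player f)

/-- The signed payload that a message of the reliable broadcast carries. -/
def Msg.signed {f : ℕ} {V : Type*} : Msg f V → Option (Signed f V)
  | .init s => some s
  | .echo s => some s
  | .ready s => some s
  | _ => none

/-- The signed votes inside a ciphertext. -/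
def Cipher.HasVote {f : ℕ} {V : Type*} (c : Cipher f V) (w : Vote f V) : Prop :=
  ∃ B, c.plain = Plain.pofs B ∧ ∃ π ∈ B,
    w = ⟨π.culprit, π.view, π.value₁⟩ ∨ w = ⟨π.culprit, π.view, π.value₂⟩

/-- The message attributes the commitment `c` to player `j`: it carries `c` as a commitment signed
by `j`, or an RB2 list (of any player) with entry `c` at `j`. -/
def Msg.Mentions {f : ℕ} {V : Type*} (m : Msg f V) (j : Player f) (c : Cipher f V) : Prop :=
  m.signed = some ⟨j, .commit c⟩ ∨ ∃ q L, m.signed = some ⟨q, .list L⟩ ∧ L j = some c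

/-- The signed votes inside a message. -/
def Msg.HasVote {f : ℕ} {V : Type*} (m : Msg f V) (w : Vote f V) : Prop :=
  m = .vote w ∨ ∃ j c, m.Mentions j c ∧ c.HasVote w

/-! ### Runs -/

/-- One step of a run.  `send p D m`: player `p` sends `m` to the players in `D`.
`recv p q m`: the scheduler delivers to `p` the message `m` sent by `q`.
`deliver p s`: player `p` RB-delivers `s`. -/
inductive Event (f : ℕ) (V : Type*) : Type _
  | idle
  | send (p : Player f) (D : Set (Player f)) (m : Msg f V)
  | recv (p q : Player f) (m : Msg f V)
  | deliver (p : Player f) (s : Signed f V)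

/-- A run, as the sequence of its events. -/
abbrev Trace (f : ℕ) (V : Type*) : Type _ := ℕ → Event f V

variable {f : ℕ} {V : Type*}

/-- At least `m` players satisfy `S`. -/
def AtLeast (m : ℕ) (S : Player f → Prop) : Prop :=
  ∃ D : Finset (Player f), m ≤ D.card ∧ ∀ i ∈ D, S i

/-- Before time `τ`, player `p` has received `m` from `q`. -/
def Received (x : Trace f V) (p : Player f) (τ : ℕ) (q : Player f) (m : Msg f V) : Prop :=
  ∃ τ' < τ, x τ' = .recv p q m

/-- Before time `τ`, player `p` has RB-delivered `s`. -/
def Delivered (x : Trace f V) (p : Player f) (τ : ℕ) (s : Signed f V) : Prop :=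
  ∃ τ' < τ, x τ' = .deliver p s

/-- Before time `τ`, player `p` has sent `m` (to somebody). -/
def Sent (x : Trace f V) (p : Player f) (τ : ℕ) (m : Msg f V) : Prop :=
  ∃ τ' < τ, ∃ D, x τ' = .send p D m

/-- At time `τ` the local state of `p` satisfies `|rb1| ≥ 4f + 1`. -/
def RB1Full (x : Trace f V) (p : Player f) (τ : ℕ) : Prop :=
  AtLeast (4 * f + 1) fun j => ∃ c, Delivered x p τ ⟨j, .commit c⟩

/-- At time `τ` the local state of `p` satisfies `|rb2| ≥ 4f + 1`. -/
def RB2Full (x : Trace f V) (p : Player f) (τ : ℕ) : Prop :=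
  AtLeast (4 * f + 1) fun j => ∃ L, Delivered x p τ ⟨j, .list L⟩

/-- The data that player `p` may commit at time `τ`: proofs of fraud extracted from votes that it
received, or the hash of a value for which it holds a certificate of `4f + 1` votes. -/
def MayCommit (x : Trace f V) (p : Player f) (τ : ℕ) : Plain f V → Prop
  | .pofs B => VerifyPoFs B ∧ ∀ π ∈ B,
      (∃ q, Received x p τ q (.vote ⟨π.culprit, π.view, π.value₁⟩)) ∧
      (∃ q, Received x p τ q (.vote ⟨π.culprit, π.view, π.value₂⟩))
  | .hash v => ∃ view, AtLeast (4 * f + 1) fun i =>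
      ∃ q, Received x p τ q (.vote ⟨i, view, v⟩)

/-- The protocol allows player `p` to broadcast the message at time `τ`.
* Votes: own ones, never two different values in one view.
* `init`: start of the own RB1 with `Enc(k_p, PoFs)` or `Enc(k_p, H(v))`, once; start of the own
  RB2 with the current content of `rb1`, once, as soon as `|rb1| ≥ 4f + 1`.
* `echo`, `ready`: Bracha's reliable broadcast for `n = 5f + 1` with up to `f` faults.
* `key`: reveal of the own key when `|rb1|, |rb2| ≥ 4f + 1`. -/
def Allowed (x : Trace f V) (p : Player f) (τ : ℕ) : Msg f V → Prop
  | .vote w => w.signer = p ∧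
      ∀ w', Sent x p τ (.vote w') → w'.view = w.view → w'.value = w.value
  | .init ⟨i, .commit c⟩ => i = p ∧ c.owner = p ∧ MayCommit x p τ c.plain ∧
      ∀ c', ¬ Sent x p τ (.init ⟨p, .commit c'⟩)
  | .init ⟨i, .list L⟩ => i = p ∧ RB1Full x p τ ∧
      (∀ j c, L j = some c ↔ Delivered x p τ ⟨j, .commit c⟩) ∧
      ∀ L', ¬ Sent x p τ (.init ⟨p, .list L'⟩)
  | .echo s => Received x p τ s.signer (.init s) ∧
      ∀ s', s.SameInstance s' → ¬ Sent x p τ (.echo s')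
  | .ready s => (AtLeast (3 * f + 1) (fun q => Received x p τ q (.echo s)) ∨
        AtLeast (f + 1) (fun q => Received x p τ q (.ready s))) ∧
      ∀ s', s.SameInstance s' → ¬ Sent x p τ (.ready s')
  | .key i => i = p ∧ RB1Full x p τ ∧ RB2Full x p τ

/-- RB-delivery of `s` is allowed for `p` at time `τ`: `2f + 1` players sent `ready` for it, and
nothing was delivered before in this instance. -/
def MayDeliver (x : Trace f V) (p : Player f) (τ : ℕ) (s : Signed f V) : Prop :=
  AtLeast (2 * f + 1) (fun q => Received x p τ q (.ready s)) ∧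
    ∀ s', s.SameInstance s' → ¬ Delivered x p τ s'

/-- The run `x` follows the baiting strategy for player `b`, so far as it concerns the BFTCR phase:
`b` broadcasts the encryption of a valid bundle of proofs of fraud in RB1 and signs no other
commitment; it delivers according to the reliable broadcast protocol; and it does not reveal its
key before `|rb1|, |rb2| ≥ 4f + 1`. -/
structure FollowsBaiting (x : Trace f V) (b : Player f) : Prop where
  commits : ∃ B, VerifyPoFs B ∧
    (∃ τ, x τ = .send b Set.univ (.init ⟨b, .commit ⟨b, .pofs B⟩⟩)) ∧
    ∀ τ D m c, x τ = .send b D m → m.signed = some ⟨b, .commit c⟩ → c = ⟨b, .pofs B⟩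
  delivers : ∀ τ s, x τ = .deliver b s → MayDeliver x b τ s
  reveals : ∀ τ D, x τ = .send b D (.key b) → RB1Full x b τ ∧ RB2Full x b τ

/-- `x` is a run in which the players have the given roles and the players in `P` are baiters.
Rational players outside `P` and Byzantine players are unrestricted, also in the reliable
broadcasts, except that they cannot forge signatures of correct players and of baiters.  The
scheduler is unrestricted; a correct player that is able to start RB2 starts it at some time. -/
structure IsRun (role : Player f → Role) (P : Finset (Player f)) (x : Trace f V) : Prop where
  channels : ∀ τ p q m, x τ = .recv p q m → ∃ τ' < τ, ∃ D, p ∈ D ∧ x τ' = .send q D m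
  unforgeable : ∀ τ p D m s, x τ = .send p D m → m.signed = some s →
    (role s.signer = .correct ∨ s.signer ∈ P) →
    ∃ τ' ≤ τ, ∃ D' m', x τ' = .send s.signer D' m' ∧ m'.signed = some s
  unforgeable_votes : ∀ τ p D m w, x τ = .send p D m → m.HasVote w → role w.signer = .correct →
    ∃ τ' ≤ τ, x τ' = .send w.signer Set.univ (.vote w)
  correct_sends : ∀ τ p D m, role p = .correct → x τ = .send p D m →
    D = Set.univ ∧ Allowed x p τ m
  correct_delivers : ∀ τ p s, role p = .correct → x τ = .deliver p s → MayDeliver x p τ s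
  correct_starts_RB2 : ∀ τ p, role p = .correct → RB1Full x p τ →
    ∃ τ' L, x τ' = .send p Set.univ (.init ⟨p, .list L⟩)
  baiters : ∀ b ∈ P, role b = .rational ∧ FollowsBaiting x b

/-- A fork with `a` branches in the run `x`.  The correct players are partitioned (by `branch`), and
each branch `r` has its own value and a quorum of at least `4f + 1` players that all voted for this
value (in one and the same view) and whose RB1 messages are delivered to the correct players of the
partition `r` before these start RB2. -/
structure Fork (role : Player f → Role) (x : Trace f V) (a : ℕ) where
  view : ℕ
  value : Fin a → V
  branch : Player f → Fin a
  quorum : Fin a → Finset (Player f)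
  value_injective : Function.Injective value
  le_card_quorum : ∀ r, 4 * f + 1 ≤ (quorum r).card
  voted : ∀ r, ∀ i ∈ quorum r, ∃ τ D, x τ = .send i D (.vote ⟨i, view, value r⟩)
  reached : ∀ p, role p = .correct → ∃ τ,
    (∀ i ∈ quorum (branch p), ∃ c, Delivered x p τ ⟨i, .commit c⟩) ∧
    ∀ L, ¬ Sent x p τ (.init ⟨p, .list L⟩)

/-- The detected equivocators: the players in the quorums of two different branches. -/
def Fork.equivocators {role : Player f → Role} {x : Trace f V} {a : ℕ} (F : Fork role x a) :
    Set (Player f) :=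
  {i | ∃ r s, r ≠ s ∧ i ∈ F.quorum r ∧ i ∈ F.quorum s}

/-! ### Candidates -/

/-- Player `j` reveals its decryption key in the run `x`. -/
def Reveals (x : Trace f V) (j : Player f) : Prop :=
  ∃ τ D, x τ = .send j D (.key j)

/-- In the run `x` some RB2 message with a list `L` signed by `q` is sent. -/
def BroadcastsList (x : Trace f V) (q : Player f) (L : Player f → Option (Cipher f V)) : Prop :=
  ∃ τ p D m, x τ = .send p D m ∧ m.signed = some ⟨q, .list L⟩

/-- Player `j` is a valid candidate with respect to the set `E` of detected equivocators: it reveals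
a ciphertext `c` that decrypts to a valid bundle of proofs of fraud, and the RB2 lists of at least
`f + 1` players outside `E` contain `c` as commitment of `j`.  A player that broadcasts two
different RB2 lists is an equivocator, and its lists do not count. -/
def IsValidCandidate (x : Trace f V) (E : Set (Player f)) (j : Player f) : Prop :=
  Reveals x j ∧ ∃ c, IsPoFCommitment j c ∧
    ∃ Q : Finset (Player f), f + 1 ≤ Q.card ∧ (∀ q ∈ Q, q ∉ E) ∧
      ∀ q ∈ Q, ∃ L, BroadcastsList x q L ∧ L j = some c ∧ ∀ L', BroadcastsList x q L' → L' = L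

/-- The same with the weaker requirement that, for each of the `f + 1` players outside `E`, any one
of possibly many RB2 lists that it broadcasts contains the commitment. -/
def IsWeakCandidate (x : Trace f V) (E : Set (Player f)) (j : Player f) : Prop :=
  Reveals x j ∧ ∃ c, IsPoFCommitment j c ∧
    ∃ Q : Finset (Player f), f + 1 ≤ Q.card ∧ (∀ q ∈ Q, q ∉ E) ∧
      ∀ q ∈ Q, ∃ L, BroadcastsList x q L ∧ L j = some c

/-- Player `j` commits proofs of fraud in RB1: some message is sent that carries, with the signature
of `j`, an RB1 commitment to a valid bundle. -/
def CommitsPoFs (x : Trace f V) (j : Player f) : Prop :=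
  ∃ τ p D m c, x τ = .send p D m ∧ m.signed = some ⟨j, .commit c⟩ ∧ IsPoFCommitment j c

/-- Before time `τ` some message is sent that attributes to `j` a commitment to a valid bundle of
proofs of fraud (as an RB1 message signed by `j`, or as an entry of somebody's RB2 list). -/
def PoFsCommittedBefore (x : Trace f V) (j : Player f) (τ : ℕ) : Prop :=
  ∃ τ' < τ, ∃ p D m c, x τ' = .send p D m ∧ m.Mentions j c ∧ IsPoFCommitment j c

end SNARE

namespace SNARE

variable {f a : ℕ} {V : Type*} {role : Player f → Role} {P : Finset (Player f)} {x : Trace f V}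

/-! Everything rests on causality, signatures and counting among `5f + 1` players; agreement of the
reliable broadcast is never needed. A delivery that follows the protocol presupposes a `ready`, so
the payload was sent earlier.

Baiters: the coalition bound gives `C ≤ 4f`, so at least `f + 1` players are correct. They vote once
per view, hence lie outside the detected equivocators, and each lists the commitments of its whole
branch quorum (`Fork.exists_list_of_correct`). A baiter in all quorums signs a single commitment, so
all these lists support the same ciphertext.

Non-baiters: any `f + 1` players outside the equivocators include a correct one
(`Fork.exists_correct_of_card`), whose entries were really signed by their owner. For late
commitments, the `4f + 1` lists delivered before a reveal meet the `f + 1` supporting lists in a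
player with only one list; that list was therefore sent before the reveal. -/

theorem AtLeast.exists_of_pos {m : ℕ} {S : Player f → Prop} (h : AtLeast m S) (hm : 0 < m) :
    ∃ i, S i := by
  obtain ⟨D, hD, hS⟩ := h
  obtain ⟨i, hi⟩ := Finset.card_pos.mp (hm.trans_le hD)
  exact ⟨i, hS i hi⟩

theorem Delivered.mono {p : Player f} {τ τ' : ℕ} {s : Signed f V} (h : Delivered x p τ s)
    (hτ : τ ≤ τ') : Delivered x p τ' s := by
  obtain ⟨σ, hσ, e⟩ := h
  exact ⟨σ, hσ.trans_le hτ, e⟩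

/-! ### Causality and signatures -/

theorem IsRun.sent_of_received (hx : IsRun role P x) {p q : Player f} {τ : ℕ} {m : Msg f V}
    (h : Received x p τ q m) : Sent x q τ m := by
  obtain ⟨σ, hσ, e⟩ := h
  obtain ⟨σ', hσ', D, -, e'⟩ := hx.channels σ p q m e
  exact ⟨σ', hσ'.trans hσ, D, e'⟩

/-- Players that deliver according to the reliable broadcast protocol deliver only payloads that
were sent before. -/
theorem IsRun.exists_sent_of_delivered (hx : IsRun role P x) {p : Player f} {τ : ℕ}
    {s : Signed f V} (hp : role p = .correct ∨ p ∈ P) (h : Delivered x p τ s) :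
    ∃ τ' < τ, ∃ q D m, x τ' = .send q D m ∧ m.signed = some s := by
  obtain ⟨σ, hσ, e⟩ := h
  have hd : MayDeliver x p σ s := by
    rcases hp with hp | hp
    · exact hx.correct_delivers σ p s hp e
    · exact (hx.baiters p hp).2.delivers σ s e
  obtain ⟨q, hq⟩ := hd.1.exists_of_pos (Nat.succ_pos _)
  obtain ⟨σ', hσ', D, e'⟩ := hx.sent_of_received hq
  exact ⟨σ', hσ'.trans hσ, q, D, _, e', rfl⟩

/-- Every payload with the signature of a correct player stems from an `init` of this player. -/
theorem IsRun.exists_init_of_signed (hx : IsRun role P x) {s : Signed f V}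
    (hs : role s.signer = .correct) (τ : ℕ) :
    ∀ p D m, x τ = .send p D m → m.signed = some s →
      ∃ τ' ≤ τ, ∃ D', x τ' = .send s.signer D' (.init s) := by
  induction τ using Nat.strong_induction_on with
  | _ τ ih =>
    intro p D m e hm
    obtain ⟨σ, hσ, D', m', e', hm'⟩ := hx.unforgeable τ p D m s e hm (.inl hs)
    -- If the signer merely echoed or readied `s`, it had received `s` before, from a strictly
    -- earlier send; descent in time must end at an `init`.
    have back : ∀ q m'', Received x s.signer σ q m'' → m''.signed = some s →
        ∃ τ' ≤ τ, ∃ D', x τ' = .send s.signer D' (.init s) := by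
      intro q m'' hr hm''
      obtain ⟨ρ, hρ, D'', e''⟩ := hx.sent_of_received hr
      obtain ⟨τ', hτ', h⟩ := ih ρ (hρ.trans_le hσ) q D'' m'' e'' hm''
      exact ⟨τ', hτ'.trans (hρ.le.trans hσ), h⟩
    have hal := (hx.correct_sends σ _ D' m' hs e').2
    cases m' with
    | vote w => simp [Msg.signed] at hm'
    | key i => simp [Msg.signed] at hm'
    | init s' =>
      obtain rfl : s' = s := by simpa [Msg.signed] using hm'
      exact ⟨σ, hσ, D', e'⟩
    | echo s' =>
      obtain rfl : s' = s := by simpa [Msg.signed] using hm'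
      exact back _ _ hal.1 rfl
    | ready s' =>
      obtain rfl : s' = s := by simpa [Msg.signed] using hm'
      rcases hal.1 with h | h
      · obtain ⟨q, hq⟩ := h.exists_of_pos (Nat.succ_pos _)
        exact back _ _ hq rfl
      · obtain ⟨q, hq⟩ := h.exists_of_pos (Nat.succ_pos _)
        exact back _ _ hq rfl

theorem IsRun.exists_init_of_broadcastsList (hx : IsRun role P x) {q : Player f}
    {L : Player f → Option (Cipher f V)} (hq : role q = .correct) (h : BroadcastsList x q L) :
    ∃ τ D, x τ = .send q D (.init ⟨q, .list L⟩) := by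
  obtain ⟨τ, p, D, m, e, hm⟩ := h
  obtain ⟨τ', -, D', e'⟩ :=
    hx.exists_init_of_signed (s := ⟨q, .list L⟩) hq τ p D m e hm
  exact ⟨τ', D', e'⟩

/-- A correct player broadcasts at most one RB2 list. -/
theorem IsRun.broadcastsList_unique (hx : IsRun role P x) {q : Player f}
    {L L' : Player f → Option (Cipher f V)} (hq : role q = .correct)
    (h : BroadcastsList x q L) (h' : BroadcastsList x q L') : L' = L := by
  obtain ⟨τ, D, e⟩ := hx.exists_init_of_broadcastsList hq h
  obtain ⟨τ', D', e'⟩ := hx.exists_init_of_broadcastsList hq h'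
  have hal := (hx.correct_sends τ _ _ _ hq e).2
  have hal' := (hx.correct_sends τ' _ _ _ hq e').2
  rcases lt_trichotomy τ τ' with h | rfl | h
  · exact (hal'.2.2.2 L ⟨τ, h, D, e⟩).elim
  · rw [e] at e'
    simp only [Event.send.injEq, Msg.init.injEq, Signed.mk.injEq, Payload.list.injEq] at e'
    exact e'.2.2.2.symm
  · exact (hal.2.2.2 L' ⟨τ', h, D', e'⟩).elim

/-- The entries of the RB2 list of a correct player were delivered to this player. -/
theorem IsRun.exists_delivered_of_mem_list (hx : IsRun role P x) {q j : Player f}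
    {L : Player f → Option (Cipher f V)} {c : Cipher f V} (hq : role q = .correct)
    (h : BroadcastsList x q L) (hL : L j = some c) :
    ∃ τ, Delivered x q τ ⟨j, .commit c⟩ := by
  obtain ⟨τ, D, e⟩ := hx.exists_init_of_broadcastsList hq h
  exact ⟨τ, ((hx.correct_sends τ _ _ _ hq e).2.2.2.1 j c).1 hL⟩

/-- A correct player votes for at most one value in each view. -/
theorem IsRun.vote_unique (hx : IsRun role P x) {p : Player f} (hp : role p = .correct)
    {τ τ' view : ℕ} {D D' : Set (Player f)} {v v' : V}
    (e : x τ = .send p D (.vote ⟨p, view, v⟩)) (e' : x τ' = .send p D' (.vote ⟨p, view, v'⟩)) :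
    v = v' := by
  have hal := (hx.correct_sends τ _ _ _ hp e).2
  have hal' := (hx.correct_sends τ' _ _ _ hp e').2
  rcases lt_trichotomy τ τ' with h | rfl | h
  · exact hal'.2 _ ⟨τ, h, D, e⟩ rfl
  · rw [e] at e'
    simp only [Event.send.injEq, Msg.vote.injEq, Vote.mk.injEq] at e'
    exact e'.2.2.2.2
  · exact (hal.2 _ ⟨τ', h, D', e'⟩ rfl).symm

/-! ### Equivocators and quorum counting -/

theorem Fork.not_mem_equivocators_of_correct (hx : IsRun role P x) (F : Fork role x a)
    {p : Player f} (hp : role p = .correct) : p ∉ F.equivocators := by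
  rintro ⟨r, s, hrs, hr, hs⟩
  obtain ⟨τ, D, e⟩ := F.voted r p hr
  obtain ⟨τ', D', e'⟩ := F.voted s p hs
  exact hrs (F.value_injective (hx.vote_unique hp e e'))

/-- Two quorums share at least `3f + 1` players. -/
theorem Fork.le_card_inter (F : Fork role x a) (r s : Fin a) :
    3 * f + 1 ≤ (F.quorum r ∩ F.quorum s).card := by
  have h := Finset.card_union_add_card_inter (F.quorum r) (F.quorum s)
  have hu := Finset.card_le_univ (F.quorum r ∪ F.quorum s)
  rw [Fintype.card_fin] at hu
  have hr := F.le_card_quorum r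
  have hs := F.le_card_quorum s
  omega

theorem card_correct_add_card_coalition (role : Player f → Role) :
    (Finset.univ.filter fun p => role p = .correct).card +
      ((Finset.univ.filter fun p => role p = .rational).card +
        (Finset.univ.filter fun p => role p = .byzantine).card) = 5 * f + 1 := by
  have h := Finset.card_eq_sum_card_fiberwise (f := role) (s := Finset.univ)
    (t := {.correct, .rational, .byzantine})
    (fun p _ => by cases h : role p <;> simp)
  simpa using h.symm

/-- If the coalition has at most `4f + 1` members, then among any `f + 1` players outside the
detected equivocators there is a correct one. -/
theorem Fork.exists_correct_of_card (hx : IsRun role P x) (F : Fork role x a) (ha : 2 ≤ a)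
    (hC : (Finset.univ.filter fun p => role p = .rational).card +
      (Finset.univ.filter fun p => role p = .byzantine).card ≤ 4 * f + 1)
    {Q : Finset (Player f)} (hQ : f + 1 ≤ Q.card) (hQE : ∀ q ∈ Q, q ∉ F.equivocators) :
    ∃ q ∈ Q, role q = .correct := by
  by_contra! hno
  let r : Fin a := ⟨0, by omega⟩
  let s : Fin a := ⟨1, by omega⟩
  have hrs : r ≠ s := by simp [r, s]
  let K := Finset.univ.filter fun p => role p = .correct
  let I := F.quorum r ∩ F.quorum s
  have hIE : ∀ i ∈ I, i ∈ F.equivocators := fun i hi =>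
    ⟨r, s, hrs, (Finset.mem_inter.mp hi).1, (Finset.mem_inter.mp hi).2⟩
  have hQI : Disjoint Q I :=
    Finset.disjoint_left.mpr fun q hq hi => hQE q hq (hIE q hi)
  have hQIK : Disjoint (Q ∪ I) K := by
    refine Finset.disjoint_left.mpr fun q hq hqK => ?_
    have hc : role q = .correct := (Finset.mem_filter.mp hqK).2
    rcases Finset.mem_union.mp hq with hq | hq
    · exact hno q hq hc
    · exact F.not_mem_equivocators_of_correct hx hc (hIE q hq)
  -- Three disjoint sets of sizes at least `f + 1`, `3f + 1` and `f` would need `5f + 2` players.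
  have hu := Finset.card_le_univ ((Q ∪ I) ∪ K)
  rw [Finset.card_union_of_disjoint hQIK, Finset.card_union_of_disjoint hQI,
    Fintype.card_fin] at hu
  have hI : 3 * f + 1 ≤ I.card := F.le_card_inter r s
  have hK := card_correct_add_card_coalition role
  change K.card + _ = _ at hK
  omega

/-- Every delivered commitment of a baiter is its commitment to proofs of fraud. -/
theorem IsRun.delivered_baiter_commit (hx : IsRun role P x) {b p : Player f} (hb : b ∈ P)
    (hp : role p = .correct) {B : List (PoF f V)}
    (hB : ∀ τ D m c, x τ = .send b D m → m.signed = some ⟨b, .commit c⟩ → c = ⟨b, .pofs B⟩)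
    {τ : ℕ} {c : Cipher f V} (h : Delivered x p τ ⟨b, .commit c⟩) : c = ⟨b, .pofs B⟩ := by
  obtain ⟨σ, -, q, D, m, e, hm⟩ := hx.exists_sent_of_delivered (.inl hp) h
  obtain ⟨σ', -, D', m', e', hm'⟩ := hx.unforgeable σ q D m _ e hm (.inr hb)
  exact hB σ' D' m' c e' hm'

/-- The RB2 list of a correct player contains the commitments of all members of the quorum of
its branch. -/
theorem Fork.exists_list_of_correct (hx : IsRun role P x) (F : Fork role x a) {p : Player f}
    (hp : role p = .correct) :
    ∃ L, BroadcastsList x p L ∧ ∀ i ∈ F.quorum (F.branch p),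
      ∃ c τ, Delivered x p τ ⟨i, .commit c⟩ ∧ L i = some c := by
  obtain ⟨τ, hdel, hns⟩ := F.reached p hp
  obtain ⟨τ', L, e⟩ := hx.correct_starts_RB2 τ p hp ⟨_, F.le_card_quorum _, hdel⟩
  -- RB2 starts only after the whole branch quorum has been delivered, so the list includes all of
  -- it.
  have hτ : τ ≤ τ' := not_lt.mp fun h => hns L ⟨τ', h, _, e⟩
  refine ⟨L, ⟨τ', p, _, _, e, rfl⟩, fun i hi => ?_⟩
  obtain ⟨c, hc⟩ := hdel i hi
  exact ⟨c, τ, hc, ((hx.correct_sends τ' _ _ _ hp e).2.2.2.1 i c).2 (hc.mono hτ)⟩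

/-- The correct players of all branches together form the supporting set: whatever the branch of
`q`, its quorum contains `b`. -/
theorem Fork.isValidCandidate_of_baiter (hx : IsRun role P x) (F : Fork role x a)
    (hK : f + 1 ≤ (Finset.univ.filter fun p => role p = .correct).card)
    {b : Player f} (hb : b ∈ P) (hbq : ∀ r, b ∈ F.quorum r) (hr : Reveals x b) :
    IsValidCandidate x F.equivocators b := by
  obtain ⟨B, hV, -, hB⟩ := (hx.baiters b hb).2.commits
  refine ⟨hr, ⟨b, .pofs B⟩, ⟨B, by simp [Cipher.dec], hV⟩, _, hK, fun q hq => ?_, fun q hq => ?_⟩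
  · exact F.not_mem_equivocators_of_correct hx (Finset.mem_filter.mp hq).2
  · have hc : role q = .correct := (Finset.mem_filter.mp hq).2
    obtain ⟨L, hL, hLq⟩ := F.exists_list_of_correct hx hc
    obtain ⟨c, τ, hd, hLb⟩ := hLq b (hbq _)
    obtain rfl := hx.delivered_baiter_commit hb hc hB hd
    exact ⟨L, hL, hLb, fun L' hL' => hx.broadcastsList_unique hc hL hL'⟩

/-- One correct supporter suffices, and its list is tied to its own deliveries; this is why multiple
lists from other players do no harm. -/
theorem Fork.commitsPoFs_of_isWeakCandidate (hx : IsRun role P x) (F : Fork role x a)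
    (ha : 2 ≤ a)
    (hC : (Finset.univ.filter fun p => role p = .rational).card +
      (Finset.univ.filter fun p => role p = .byzantine).card ≤ 4 * f + 1)
    {j : Player f} (h : IsWeakCandidate x F.equivocators j) : CommitsPoFs x j := by
  obtain ⟨-, c, hc, Q, hQ, hQE, hQL⟩ := h
  obtain ⟨q, hqQ, hq⟩ := F.exists_correct_of_card hx ha hC hQ hQE
  obtain ⟨L, hL, hLj⟩ := hQL q hqQ
  obtain ⟨τ, hd⟩ := hx.exists_delivered_of_mem_list hq hL hLj
  obtain ⟨τ', -, p, D, m, e, hm⟩ := hx.exists_sent_of_delivered (.inl hq) hd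
  exact ⟨τ', p, D, m, c, e, hm, hc⟩

theorem IsRun.rb2Full_of_reveal (hx : IsRun role P x) {p : Player f} {τ : ℕ}
    {D : Set (Player f)} (hp : role p = .correct ∨ p ∈ P) (e : x τ = .send p D (.key p)) :
    RB2Full x p τ := by
  rcases hp with hp | hp
  · exact (hx.correct_sends τ _ _ _ hp e).2.2.2
  · exact ((hx.baiters p hp).2.reveals τ D e).2

/-- The `4f + 1` lists delivered before a reveal meet the `f + 1` lists that support a valid
candidate. -/
theorem IsRun.poFsCommittedBefore_of_isValidCandidate (hx : IsRun role P x)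
    {E : Set (Player f)} {p j : Player f} {τ : ℕ} (hp : role p = .correct ∨ p ∈ P)
    (hfull : RB2Full x p τ) (h : IsValidCandidate x E j) : PoFsCommittedBefore x j τ := by
  obtain ⟨-, c, hc, Q, hQ, -, hQL⟩ := h
  obtain ⟨S, hS, hSL⟩ := hfull
  -- The sizes add up to `(f + 1) + (4f + 1) > 5f + 1`. The common player may belong to the
  -- coalition.
  obtain ⟨q, hqQ, hqS⟩ : ∃ q ∈ Q, q ∈ S := by
    by_contra! hno
    have hu := Finset.card_le_univ (Q ∪ S)
    rw [Finset.card_union_of_disjoint (Finset.disjoint_left.mpr hno), Fintype.card_fin] at hu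
    omega
  obtain ⟨L, -, hLj, huniq⟩ := hQL q hqQ
  obtain ⟨L', hd⟩ := hSL q hqS
  obtain ⟨τ', hτ', p', D', m, e, hm⟩ := hx.exists_sent_of_delivered hp hd
  -- Discarding players with two lists is essential here: it identifies the list delivered before
  -- the reveal with the supporting one.
  obtain rfl := huniq L' ⟨τ', p', D', m, e, hm⟩
  exact ⟨τ', hτ', p', D', m, c, e, .inr ⟨q, L', hm, hLj⟩, hc⟩

end SNARE

theorem mainTheorem4 {f k t a : ℕ} {V : Type*} (hf : 3 ≤ f)
    (role : SNARE.Player f → SNARE.Role)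
    (hk : (Finset.univ.filter fun p => role p = SNARE.Role.rational).card = k)
    (ht : (Finset.univ.filter fun p => role p = SNARE.Role.byzantine).card = t)
    (htf : t ≤ f) (hC : k + t ≤ (11 * f + 2) / 3)
    (P : Finset (SNARE.Player f)) (x : SNARE.Trace f V) (hx : SNARE.IsRun role P x)
    (ha : 2 ≤ a) (F : SNARE.Fork role x a) :
    -- (i) baiters that take part in the fork become valid candidates upon reveal
    (∀ b ∈ P, (∀ r, b ∈ F.quorum r) → SNARE.Reveals x b →
      SNARE.IsValidCandidate x F.equivocators b) ∧
    -- (ii) players that do not commit proofs of fraud in RB1 do not become candidates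
    (∀ j, ¬ SNARE.CommitsPoFs x j → ¬ SNARE.IsWeakCandidate x F.equivocators j) ∧
    -- (ii) nor do players that commit them only after a correct player or a baiter has revealed
    (∀ p τ D, (role p = SNARE.Role.correct ∨ p ∈ P) →
      x τ = SNARE.Event.send p D (SNARE.Msg.key p) →
      ∀ j, ¬ SNARE.PoFsCommittedBefore x j τ →
        ¬ SNARE.IsValidCandidate x F.equivocators j) := by
  have hsum := SNARE.card_correct_add_card_coalition role
  refine ⟨fun b hb hbq hr => F.isValidCandidate_of_baiter hx (by omega) hb hbq hr,
    fun j hj h => hj (F.commitsPoFs_of_isWeakCandidate hx ha (by omega) h),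
    fun p τ D hp e j hj h => hj (hx.poFsCommittedBefore_of_isValidCandidate hp
      (hx.rb2Full_of_reveal hp e) h)⟩
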